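/- There is a universal constant $c>0$ such that the following holds. Let $T,K>1$ be integers and let $\epsilon(1),\dots,\epsilon(K)\ge 0$ be such that $\epsilon(j)^2\ge \frac{2}{T}\sum_{i=1}^{K}\epsilon(i)^2$ for every $j$ with $\epsilon(j)>0$. A learner plays $T$ rounds against a loss assignment $\ell_t(j)\in\mathbb{R}$ ($1\le t\le T$, $1\le j\le K$) fixed in advance: in each round $t$ it chooses an arm $I_t\in\{1,\dots,K\}$ as a function of its coin flips and of its earlier choices and observations, and afterwards observes $\ell_t(I_t)$ (bandit feedback) or the whole vector $(\ell_t(1),\dots,\ell_t(K))$ (full-information feedback). Then there exist real numbers $m(1),\dots,m(K)$, the same for both kinds of feedback, such that for every (possibly randomized) learner strategy $A$ there is a loss assignment with $|\ell_t(j)-m(j)|\le\epsilon(j)$ for all $t,j$ and $$\mathbb{E}_A\left[\sum_{t=1}^{T}\ell_t(I_t)\right]-\min_{j=1,\dots,K}\sum_{t=1}^{T}\ell_t(j)\;\ge\;\begin{cases} c\sqrt{T\sum_{j=1}^{K}\epsilon(j)^2} & \text{with bandit feedback,}\\[1mm] c\sqrt{T\max_{j=1,\dots,K}\epsilon(j)^2}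 & \text{with full-information feedback,}\end{cases}$$ where the expectation is over the coin flips of $A$. Moreover, if $\epsilon(j)\le\frac12$ for all $j$, the $m(j)$ can be taken with $[m(j)-\epsilon(j),m(j)+\epsilon(j)]\subseteq[0,1]$ for all $j$, so that all these losses lie in $[0,1]$. -/

import Mathlib

universe u

namespace NonstochasticBandit

/-- A (possibly randomized) learner strategy with `K` arms and per-round observations in `F`.
The learner's coin flips are a point `ω` of a measurable space `Ω`. The arm chosen in a round is a
function of the coin flips and of the list of all earlier rounds' (chosen arm, observation) pairs,
oldest first; the number of the round is the length of that list. -/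
structure Learner (Ω : Type u) [MeasurableSpace Ω] (K : ℕ) (F : Type) where
  act : Ω → List (Fin K × F) → Fin K
  measurable_act : ∀ h : List (Fin K × F), Measurable fun ω => act ω h

/-- Bandit feedback: the learner observes only the loss of the chosen arm. -/
def banditFeedback {K : ℕ} (v : Fin K → ℝ) (i : Fin K) : ℝ := v i

/-- Full-information feedback: the learner observes the whole loss vector. -/
def fullFeedback {K : ℕ} (v : Fin K → ℝ) (_ : Fin K) : Fin K → ℝ := v

namespace Learner

variable {Ω : Type u} [MeasurableSpace Ω] {K : ℕ} {F : Type}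

/-- What the learner has seen before round `t` (rounds are numbered from `0`), when the loss
vector of round `s` is `l s`, the feedback function is `f` and the coin flips are `ω`. -/
def history (A : Learner Ω K F) (f : (Fin K → ℝ) → Fin K → F) (l : ℕ → Fin K → ℝ) (ω : Ω) :
    ℕ → List (Fin K × F)
  | 0 => []
  | t + 1 =>
    A.history f l ω t ++
      [(A.act ω (A.history f l ω t), f (l t) (A.act ω (A.history f l ω t)))]

/-- The arm `I_t` that the learner plays in round `t`. -/
def arm (A : Learner Ω K F) (f : (Fin K → ℝ) → Fin K → F) (l : ℕ → Fin K → ℝ) (t : ℕ) (ω : Ω) :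
    Fin K :=
  A.act ω (A.history f l ω t)

/-- Expected regret over the rounds `0, …, T - 1` against the fixed (oblivious) losses `l`:
the expected cumulative loss, when the coin flips have law `P`, minus the cumulative loss of the
best single arm. -/
noncomputable def expectedRegret (A : Learner Ω K F) (P : MeasureTheory.Measure Ω)
    (f : (Fin K → ℝ) → Fin K → F) (l : ℕ → Fin K → ℝ) (T : ℕ) : ℝ :=
  (∫ ω, ∑ t ∈ Finset.range T, l t (A.arm f l t ω) ∂P) - ⨅ j, ∑ t ∈ Finset.range T, l t j

end Learner

end NonstochasticBandit

/-!
All `m j` are `1 / 2` and the constant is `1 / 36`. In each case the losses are drawn at random,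
independently over the rounds, and some realization does at least as well as the average; as only
finitely many outcomes are drawn from, the average is the finite operator `seqAvg`, and the coin
flips of the learner are fixed while it is computed.

If only one arm `j` fluctuates, by an unbiased `±ε j`, and all other losses are `1 / 2`, then every
learner loses `T / 2` on average whatever it observes, while the better of `j` and another arm gains
the negative part of `ε j` times a simple random walk, of order `ε j * √T`
(`exists_loss_single_arm`). This settles full information, and also bandit feedback when one arm
carries at least half of `S = ∑ j, ε j ^ 2`.

Otherwise (`Learner.exists_loss_spread`) an arm `J` is drawn with probability `ε J ^ 2 / S`, all
arms fluctuate by `±ε i`, and the signs of `J` are biased so that its mean loss drops by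
`δ = √(S / T) / 9`; the hypothesis on `ε` makes that bias at most `1 / 2`. The regret is `δ` times
the number of rounds in which `J` is not played. A pull of `J` reveals information of order
`(δ / ε J) ^ 2` about the bias, so the number of pulls of `J` exceeds that under unbiased signs,
`N J`, by at most `T * (9 * (δ / ε J) ^ 2 * N J + 1 / 8)`: this is a Pinsker-type estimate of the
likelihood ratio of the history (`Learner.seqAvg_history`, `Learner.seqAvg_signWeight_le`). Averaged
over `J`, the factor `ε J ^ 2` of the prior cancels the `1 / ε J ^ 2` of the information, and
`∑ J, N J = T` with `ε J ^ 2 ≤ S / 2` bounds the mean number of pulls of `J` by `3 * T / 4`.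
-/

namespace NonstochasticBandit

open Finset MeasureTheory

/-! ### Averages over finitely many i.i.d. draws -/

section SeqAvg

variable {V : Type*} [Fintype V]

/-- The expectation of `Φ x` when `x 0, …, x (n - 1)` are independent draws from the weights `w`
on the finite type `V` and all later entries of the sequence `x` are frozen at `x₀`. -/
noncomputable def seqAvg (w : V → ℝ) (x₀ : V) : ℕ → ((ℕ → V) → ℝ) →ₗ[ℝ] ℝ
  | 0 => LinearMap.proj (fun _ => x₀)
  | n + 1 => seqAvg w x₀ n ∘ₗ
      { toFun := fun Φ x => ∑ v, w v * Φ (Function.update x n v)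
        map_add' := fun Φ Ψ => by
          funext x; simp [mul_add, sum_add_distrib]
        map_smul' := fun a Φ => by
          funext x; simp [mul_sum, mul_left_comm] }

variable (w : V → ℝ) (x₀ : V)

theorem seqAvg_zero (Φ : (ℕ → V) → ℝ) : seqAvg w x₀ 0 Φ = Φ fun _ => x₀ := rfl

theorem seqAvg_succ (n : ℕ) (Φ : (ℕ → V) → ℝ) :
    seqAvg w x₀ (n + 1) Φ =
      seqAvg w x₀ n fun x => ∑ v, w v * Φ (Function.update x n v) := rfl

theorem seqAvg_add (n : ℕ) (Φ Ψ : (ℕ → V) → ℝ) :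
    seqAvg w x₀ n (fun x => Φ x + Ψ x) = seqAvg w x₀ n Φ + seqAvg w x₀ n Ψ :=
  map_add _ Φ Ψ

theorem seqAvg_sub (n : ℕ) (Φ Ψ : (ℕ → V) → ℝ) :
    seqAvg w x₀ n (fun x => Φ x - Ψ x) = seqAvg w x₀ n Φ - seqAvg w x₀ n Ψ :=
  map_sub _ Φ Ψ

theorem seqAvg_const_mul (n : ℕ) (a : ℝ) (Φ : (ℕ → V) → ℝ) :
    seqAvg w x₀ n (fun x => a * Φ x) = a * seqAvg w x₀ n Φ :=
  map_smul (seqAvg w x₀ n) a Φ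

theorem seqAvg_sum {ι : Type*} (s : Finset ι) (n : ℕ) (Φ : ι → (ℕ → V) → ℝ) :
    seqAvg w x₀ n (fun x => ∑ i ∈ s, Φ i x) = ∑ i ∈ s, seqAvg w x₀ n (Φ i) := by
  rw [← map_sum]
  congr 1
  funext x
  simp

variable {w}

theorem seqAvg_const (hw : ∑ v, w v = 1) (n : ℕ) (a : ℝ) :
    seqAvg w x₀ n (fun _ => a) = a := by
  induction n with
  | zero => rfl
  | succ n ih => rw [seqAvg_succ]; simpa [← sum_mul, hw] using ih

theorem seqAvg_mono (hw : ∀ v, 0 ≤ w v) (n : ℕ) {Φ Ψ : (ℕ → V) → ℝ} (h : ∀ x, Φ x ≤ Ψ x) :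
    seqAvg w x₀ n Φ ≤ seqAvg w x₀ n Ψ := by
  induction n generalizing Φ Ψ with
  | zero => exact h _
  | succ n ih =>
    exact ih fun x => sum_le_sum fun v _ => mul_le_mul_of_nonneg_left (h _) (hw v)

theorem exists_seqAvg_le (hw : ∀ v, 0 ≤ w v) (hw1 : ∑ v, w v = 1) (n : ℕ)
    (Φ : (ℕ → V) → ℝ) : ∃ x, seqAvg w x₀ n Φ ≤ Φ x := by
  induction n generalizing Φ with
  | zero => exact ⟨_, le_rfl⟩
  | succ n ih =>
    obtain ⟨x, hx⟩ := ih fun x => ∑ v, w v * Φ (Function.update x n v)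
    by_contra! hlt
    have hlt' : ∀ v, Φ (Function.update x n v) ≤ seqAvg w x₀ (n + 1) Φ := fun v => (hlt _).le
    have hle : ∑ v, w v * Φ (Function.update x n v) ≤ ∑ v, w v * seqAvg w x₀ (n + 1) Φ :=
      sum_le_sum fun v _ => mul_le_mul_of_nonneg_left (hlt' v) (hw v)
    rw [← sum_mul, hw1, one_mul] at hle
    have heq : ∑ v, w v * Φ (Function.update x n v) = ∑ v, w v * seqAvg w x₀ (n + 1) Φ := by
      rw [← sum_mul, hw1, one_mul]
      exact le_antisymm hle (by rw [seqAvg_succ]; exact hx)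
    obtain ⟨v, -, hv⟩ : ∃ v ∈ univ, w v ≠ 0 := by
      by_contra! h0
      rw [sum_eq_zero h0] at hw1
      exact zero_ne_one hw1
    have hstrict : ∑ v, w v * Φ (Function.update x n v) < ∑ v, w v * seqAvg w x₀ (n + 1) Φ :=
      sum_lt_sum (fun v _ => mul_le_mul_of_nonneg_left (hlt' v) (hw v))
        ⟨v, mem_univ v, mul_lt_mul_of_pos_left (hlt _) (lt_of_le_of_ne (hw v) (Ne.symm hv))⟩
    exact hstrict.ne heq

/-- A per-round payoff `Ψ t x (x t)` whose form
depends only on the draws before round `t` may be replaced by its average over a fresh draw. -/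
theorem seqAvg_predictable (hw : ∑ v, w v = 1) (Ψ : ℕ → (ℕ → V) → V → ℝ)
    (hΨ : ∀ t x y, (∀ s < t, x s = y s) → Ψ t x = Ψ t y) (T : ℕ) :
    seqAvg w x₀ T (fun x => ∑ t ∈ range T, Ψ t x (x t)) =
      seqAvg w x₀ T (fun x => ∑ t ∈ range T, ∑ v, w v * Ψ t x v) := by
  induction T with
  | zero => simp
  | succ n ih =>
    have hΨu : ∀ t ≤ n, ∀ x v, Ψ t (Function.update x n v) = Ψ t x := fun t ht x v =>
      hΨ t _ _ fun s hs => Function.update_of_ne (by omega) _ _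
    have h1 : ∀ x, ∑ v, w v * ∑ t ∈ range (n + 1),
        Ψ t (Function.update x n v) (Function.update x n v t) =
        (∑ t ∈ range n, Ψ t x (x t)) + ∑ v, w v * Ψ n x v := by
      intro x
      have : ∀ v, ∑ t ∈ range (n + 1), Ψ t (Function.update x n v) (Function.update x n v t) =
          (∑ t ∈ range n, Ψ t x (x t)) + Ψ n x v := by
        intro v
        rw [sum_range_succ, hΨu n le_rfl, Function.update_self]
        congr 1
        refine sum_congr rfl fun t ht => ?_
        rw [mem_range] at ht
        rw [hΨu t ht.le, Function.update_of_ne ht.ne]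
      simp_rw [this, mul_add, sum_add_distrib, ← sum_mul, hw, one_mul]
    have h2 : ∀ x, ∑ v', w v' * ∑ t ∈ range (n + 1),
        ∑ v, w v * Ψ t (Function.update x n v') v =
        (∑ t ∈ range n, ∑ v, w v * Ψ t x v) + ∑ v, w v * Ψ n x v := by
      intro x
      have : ∀ v', ∑ t ∈ range (n + 1), ∑ v, w v * Ψ t (Function.update x n v') v =
          (∑ t ∈ range n, ∑ v, w v * Ψ t x v) + ∑ v, w v * Ψ n x v := by
        intro v'
        rw [← sum_range_succ]
        refine sum_congr rfl fun t ht => ?_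
        rw [mem_range] at ht
        rw [hΨu t (by omega)]
      simp_rw [this, ← sum_mul, hw, one_mul]
    rw [seqAvg_succ, seqAvg_succ]
    simp_rw [h1, h2]
    rw [seqAvg_add, seqAvg_add, ih]

theorem integral_seqAvg {Ω : Type*} [MeasurableSpace Ω] (P : Measure Ω) (n : ℕ)
    (Φ : Ω → (ℕ → V) → ℝ) (hΦ : ∀ x, Integrable (fun ω => Φ ω x) P) :
    Integrable (fun ω => seqAvg w x₀ n (Φ ω)) P ∧
      ∫ ω, seqAvg w x₀ n (Φ ω) ∂P = seqAvg w x₀ n fun x => ∫ ω, Φ ω x ∂P := by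
  induction n generalizing Φ with
  | zero => exact ⟨hΦ _, rfl⟩
  | succ n ih =>
    have hint : ∀ x v, Integrable (fun ω => w v * Φ ω (Function.update x n v)) P :=
      fun x v => (hΦ _).const_mul _
    have := ih (fun ω x => ∑ v, w v * Φ ω (Function.update x n v))
      fun x => integrable_finsetSum _ fun v _ => hint x v
    refine ⟨this.1, this.2.trans ?_⟩
    rw [seqAvg_succ]
    congr 1
    funext x
    rw [integral_finsetSum _ fun v _ => hint x v]
    simp_rw [integral_const_mul]

end SeqAvg

/-! ### Histories and arms played -/

namespace Learner

variable {Ω : Type u} [MeasurableSpace Ω] {K : ℕ} {F : Type}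

theorem history_congr (A : Learner Ω K F) (f : (Fin K → ℝ) → Fin K → F) (ω : Ω)
    {l l' : ℕ → Fin K → ℝ} {t : ℕ} (h : ∀ s < t, l s = l' s) :
    A.history f l ω t = A.history f l' ω t := by
  induction t with
  | zero => rfl
  | succ t ih =>
    simp only [history]
    rw [ih fun s hs => h s (by omega), h t (by omega)]

theorem arm_congr (A : Learner Ω K F) (f : (Fin K → ℝ) → Fin K → F) (ω : Ω)
    {l l' : ℕ → Fin K → ℝ} {t : ℕ} (h : ∀ s < t, l s = l' s) :
    A.arm f l t ω = A.arm f l' t ω := by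
  simp only [arm, A.history_congr f ω h]

/-- Against fixed losses only finitely many histories of a given length can occur, which is what
makes the history measurable although the observation type carries no measurable structure. -/
theorem exists_finite_history (A : Learner Ω K F) (f : (Fin K → ℝ) → Fin K → F)
    (l : ℕ → Fin K → ℝ) (t : ℕ) :
    ∃ S : Set (List (Fin K × F)), S.Finite ∧ (∀ ω, A.history f l ω t ∈ S) ∧
      ∀ h, MeasurableSet {ω | A.history f l ω t = h} := by
  induction t with
  | zero =>
    exact ⟨{[]}, Set.finite_singleton _, fun _ => rfl, fun h => MeasurableSet.const ([] = h)⟩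
  | succ t ih =>
    obtain ⟨S, hS, hmem, hmeas⟩ := ih
    refine ⟨Set.image2 (fun h i => h ++ [(i, f (l t) i)]) S Set.univ,
      hS.image2 _ Set.finite_univ, fun ω => ?_, fun h' => ?_⟩
    · exact Set.mem_image2_of_mem (hmem ω) (Set.mem_univ _)
    · have : {ω | A.history f l ω (t + 1) = h'} = ⋃ h ∈ S, ⋃ i : Fin K,
          {ω | A.history f l ω t = h} ∩ ((fun ω => A.act ω h) ⁻¹' {i}) ∩
            {_ω | h ++ [(i, f (l t) i)] = h'} := by
        ext ω
        simp only [Set.mem_ofPred_eq, Set.mem_iUnion, Set.mem_inter_iff, Set.mem_preimage,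
          Set.mem_singleton_iff, history]
        constructor
        · intro h
          exact ⟨_, hmem ω, _, ⟨rfl, rfl⟩, h⟩
        · rintro ⟨h, -, i, ⟨rfl, rfl⟩, h3⟩
          exact h3
      rw [this]
      exact hS.measurableSet_biUnion fun h _ => MeasurableSet.iUnion fun i =>
        ((hmeas h).inter (A.measurable_act h (measurableSet_singleton i))).inter
          (MeasurableSet.const _)

theorem measurable_arm (A : Learner Ω K F) (f : (Fin K → ℝ) → Fin K → F)
    (l : ℕ → Fin K → ℝ) (t : ℕ) : Measurable (A.arm f l t) := by
  obtain ⟨S, hS, hmem, hmeas⟩ := A.exists_finite_history f l t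
  refine measurable_to_countable' fun i => ?_
  have : A.arm f l t ⁻¹' {i} = ⋃ h ∈ S,
      {ω | A.history f l ω t = h} ∩ ((fun ω => A.act ω h) ⁻¹' {i}) := by
    ext ω
    simp only [Set.mem_ofPred_eq, Set.mem_iUnion, Set.mem_inter_iff, Set.mem_preimage,
      Set.mem_singleton_iff, arm]
    constructor
    · intro h
      exact ⟨_, hmem ω, rfl, h⟩
    · rintro ⟨h, -, rfl, h3⟩
      exact h3
  rw [this]
  exact hS.measurableSet_biUnion fun h _ =>
    (hmeas h).inter (A.measurable_act h (measurableSet_singleton i))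

theorem integrable_loss (A : Learner Ω K F) (P : Measure Ω) [IsProbabilityMeasure P]
    (f : (Fin K → ℝ) → Fin K → F) (l : ℕ → Fin K → ℝ) (T : ℕ) :
    Integrable (fun ω => ∑ t ∈ range T, l t (A.arm f l t ω)) P := by
  refine integrable_finsetSum _ fun t _ => ?_
  refine Integrable.of_bound (C := ∑ i, |l t i|)
    ((measurable_of_finite (l t)).comp (A.measurable_arm f l t)).aestronglyMeasurable
    (Filter.Eventually.of_forall fun ω => ?_)
  exact single_le_sum (f := fun i => |l t i|) (fun i _ => abs_nonneg _) (mem_univ _)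

/-- The learner loses, on average over random losses drawn afresh in each round, the mean loss of
the arms it plays. -/
theorem seqAvg_loss {V : Type*} [Fintype V] {w : V → ℝ} (x₀ : V) (hw : ∑ v, w v = 1)
    (A : Learner Ω K F) (f : (Fin K → ℝ) → Fin K → F) (ω : Ω) (L : V → Fin K → ℝ) (T : ℕ) :
    seqAvg w x₀ T (fun x => ∑ t ∈ range T, L (x t) (A.arm f (fun s => L (x s)) t ω)) =
      seqAvg w x₀ T (fun x => ∑ t ∈ range T,
        ∑ v, w v * L v (A.arm f (fun s => L (x s)) t ω)) := by
  refine seqAvg_predictable x₀ hw (fun t x v => L v (A.arm f (fun s => L (x s)) t ω))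
    (fun t x y h => ?_) T
  rw [A.arm_congr f ω fun s hs => congrArg L (h s hs)]

end Learner

/-! ### One fluctuating arm -/

section SingleArm

/-- The sign `±1` encoded by a Boolean. -/
def sgn (b : Bool) : ℝ := if b then 1 else -1

theorem abs_sgn (b : Bool) : |sgn b| = 1 := by
  cases b <;> simp [sgn]

/-- The simple random walk after `n` steps, driven by the coin tosses `x`. -/
def walk (x : ℕ → Bool) (n : ℕ) : ℝ := ∑ t ∈ range n, sgn (x t)

theorem walk_update (x : ℕ → Bool) (n : ℕ) (b : Bool) :
    walk (Function.update x n b) (n + 1) = walk x n + sgn b := by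
  rw [walk, sum_range_succ, Function.update_self, walk]
  congr 1
  refine sum_congr rfl fun t ht => ?_
  rw [Function.update_of_ne (mem_range.1 ht).ne]

/-- The weights of a fair coin. -/
noncomputable def fair (_ : Bool) : ℝ := 1 / 2

theorem fair_nonneg (b : Bool) : 0 ≤ fair b := by norm_num [fair]

theorem sum_fair : ∑ b, fair b = 1 := by norm_num [fair]

theorem seqAvg_walk_sq (n : ℕ) : seqAvg fair true n (fun x => walk x n ^ 2) = n := by
  induction n with
  | zero => simp [seqAvg_zero, walk]
  | succ n ih =>
    rw [seqAvg_succ]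
    have : ∀ x, ∑ b, fair b * walk (Function.update x n b) (n + 1) ^ 2 = walk x n ^ 2 + 1 := by
      intro x
      simp only [walk_update, Fintype.sum_bool, fair, sgn]
      norm_num
      ring
    simp_rw [this]
    rw [seqAvg_add, ih, seqAvg_const _ sum_fair]
    push_cast
    rfl

theorem seqAvg_walk_pow_four (n : ℕ) :
    seqAvg fair true n (fun x => walk x n ^ 4) = 3 * (n : ℝ) ^ 2 - 2 * n := by
  induction n with
  | zero => simp [seqAvg_zero, walk]
  | succ n ih =>
    rw [seqAvg_succ]
    have : ∀ x, ∑ b, fair b * walk (Function.update x n b) (n + 1) ^ 4 =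
        walk x n ^ 4 + (6 * walk x n ^ 2 + 1) := by
      intro x
      simp only [walk_update, Fintype.sum_bool, fair, sgn]
      norm_num
      ring
    simp_rw [this]
    rw [seqAvg_add, ih, seqAvg_add, seqAvg_const_mul, seqAvg_walk_sq, seqAvg_const _ sum_fair]
    push_cast
    ring

/-- A Khintchine-type bound by the fourth-moment method: `y ^ 2 - y ^ 4 / 4 ≤ |y|` is
averaged at `y = walk x n / √n`. -/
theorem sqrt_le_seqAvg_abs_walk {n : ℕ} (hn : 0 < n) :
    √n / 4 ≤ seqAvg fair true n (fun x => |walk x n|) := by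
  have hn' : (0 : ℝ) < n := by exact_mod_cast hn
  set q : ℝ := √n with hq
  have hq0 : 0 < q := Real.sqrt_pos.2 hn'
  have hqq : q ^ 2 = n := Real.sq_sqrt hn'.le
  have hpt : ∀ x : ℕ → Bool,
      q⁻¹ * walk x n ^ 2 - q⁻¹ ^ 3 / 4 * walk x n ^ 4 ≤ |walk x n| := by
    intro x
    have hy : ∀ y : ℝ, 0 ≤ y → y ^ 2 - y ^ 4 / 4 ≤ y := by
      intro y hy
      nlinarith [mul_nonneg hy (mul_nonneg hy (sq_nonneg (y - 1))),
        mul_nonneg hy (sq_nonneg (y - 5 / 4))]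
    have h := hy (q⁻¹ * |walk x n|) (by positivity)
    have h2 := mul_le_mul_of_nonneg_left h hq0.le
    have e1 : q * (q⁻¹ * |walk x n|) = |walk x n| := by field_simp
    have e2 : q * ((q⁻¹ * |walk x n|) ^ 2 - (q⁻¹ * |walk x n|) ^ 4 / 4) =
        q⁻¹ * |walk x n| ^ 2 - q⁻¹ ^ 3 / 4 * |walk x n| ^ 4 := by
      field_simp
    rw [e1, e2, sq_abs, (by decide : Even 4).pow_abs] at h2
    exact h2
  refine le_trans ?_ (seqAvg_mono true fair_nonneg n hpt)
  rw [seqAvg_sub, seqAvg_const_mul, seqAvg_const_mul, seqAvg_walk_sq, seqAvg_walk_pow_four,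
    ← hqq]
  have : q⁻¹ * q ^ 2 - q⁻¹ ^ 3 / 4 * (3 * (q ^ 2) ^ 2 - 2 * q ^ 2) = q / 4 + q⁻¹ / 2 := by
    field_simp
    ring
  rw [this]
  have : 0 ≤ q⁻¹ / 2 := by positivity
  linarith

variable {Ω : Type u} [MeasurableSpace Ω] {K : ℕ} {F : Type}

theorem Learner.le_expectedRegret (A : Learner Ω K F) (P : Measure Ω)
    (f : (Fin K → ℝ) → Fin K → F) (l : ℕ → Fin K → ℝ) (T : ℕ) (j : Fin K) :
    (∫ ω, ∑ t ∈ range T, l t (A.arm f l t ω) ∂P) - ∑ t ∈ range T, l t j ≤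
      A.expectedRegret P f l T :=
  sub_le_sub_left (ciInf_le (f := fun j => ∑ t ∈ range T, l t j)
    (Set.finite_range _).bddBelow j) _

/-- If only the arm `j` fluctuates, by an unbiased `±ε j`, then no feedback helps the learner,
whereas the better of `j` and a constant arm gains the negative part of a random walk. -/
theorem exists_loss_single_arm (A : Learner Ω K F) (P : Measure Ω) [IsProbabilityMeasure P]
    (f : (Fin K → ℝ) → Fin K → F) {ε : Fin K → ℝ} (hε : ∀ i, 0 ≤ ε i) {j j' : Fin K}
    (hj : j' ≠ j) {T : ℕ} (hT : 0 < T) :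
    ∃ l : ℕ → Fin K → ℝ, (∀ t i, |l t i - 1 / 2| ≤ ε i) ∧
      ε j * √T / 8 ≤ A.expectedRegret P f l T := by
  let L : Bool → Fin K → ℝ := fun b i => 1 / 2 + if i = j then ε j * sgn b else 0
  let l : (ℕ → Bool) → ℕ → Fin K → ℝ := fun x t => L (x t)
  have hmean : ∀ i, ∑ b, fair b * L b i = 1 / 2 := by
    intro i
    simp only [L, Fintype.sum_bool, fair, sgn]
    by_cases h : i = j
    · simp [h]
      ring
    · simp [h]
      norm_num
  have hplay : seqAvg fair true T
      (fun x => ∫ ω, ∑ t ∈ range T, l x t (A.arm f (l x) t ω) ∂P) = T / 2 := by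
    have h := (integral_seqAvg (w := fair) true P T
      (fun ω x => ∑ t ∈ range T, l x t (A.arm f (l x) t ω))
      fun x => A.integrable_loss P f (l x) T).2
    rw [← h]
    have hω : ∀ ω, seqAvg fair true T
        (fun x => ∑ t ∈ range T, l x t (A.arm f (l x) t ω)) = T / 2 := by
      intro ω
      have h := A.seqAvg_loss true sum_fair f ω L T
      simp only [hmean] at h
      refine h.trans ?_
      rw [seqAvg_const _ sum_fair]
      simp
      ring
    simp [hω]
  have hj1 : ∀ x, ∑ t ∈ range T, l x t j = T / 2 + ε j * walk x T := by
    intro x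
    simp only [l, L, if_true, sum_add_distrib, ← mul_sum, walk]
    simp
    ring
  have hj2 : ∀ x, ∑ t ∈ range T, l x t j' = T / 2 := by
    intro x
    simp [l, L, hj]
    ring
  have hwalk : seqAvg fair true T (fun x => walk x T) = 0 := by
    have h := seqAvg_predictable true sum_fair (fun _ _ b => sgn b) (fun _ _ _ _ => rfl) T
    simp only [walk]
    rw [h]
    have : ∑ b, fair b * sgn b = 0 := by simp [fair, sgn]
    simp only [this, sum_const_zero]
    exact seqAvg_const _ sum_fair _ _
  have hlow : ∀ x, (∫ ω, ∑ t ∈ range T, l x t (A.arm f (l x) t ω) ∂P) -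
      (T / 2 + (ε j / 2 * walk x T - ε j / 2 * |walk x T|)) ≤ A.expectedRegret P f (l x) T := by
    intro x
    have h1 := A.le_expectedRegret P f (l x) T j
    have h2 := A.le_expectedRegret P f (l x) T j'
    rw [hj1] at h1
    rw [hj2] at h2
    rcases abs_cases (walk x T) with h | h
    · rw [h.1]; linarith
    · rw [h.1]; linarith
  obtain ⟨x, hx⟩ := exists_seqAvg_le true fair_nonneg sum_fair T
    (fun x => A.expectedRegret P f (l x) T)
  refine ⟨l x, fun t i => ?_, le_trans ?_ hx⟩
  · simp only [l, L, add_sub_cancel_left]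
    split_ifs with h
    · rw [abs_mul, abs_sgn, mul_one, abs_of_nonneg (hε j), h]
    · simpa using hε i
  · refine le_trans ?_ (seqAvg_mono true fair_nonneg T hlow)
    rw [seqAvg_sub, hplay, seqAvg_add, seqAvg_const _ sum_fair, seqAvg_sub, seqAvg_const_mul,
      seqAvg_const_mul, hwalk]
    have := mul_le_mul_of_nonneg_left (sqrt_le_seqAvg_abs_walk hT) (hε j)
    linarith

end SingleArm

/-! ### Change of measure under bandit feedback -/

section ChangeOfMeasure

variable {Ω : Type u} [MeasurableSpace Ω] {K : ℕ} {F : Type}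

/-- The likelihood ratio of the history: if, for the observation of each single arm `i`, passing
from the weights `w₀` to `w` amounts to the density `r i`, then for functions of the history it
amounts to the product of the densities `r` of the arms played. -/
theorem Learner.seqAvg_history {V : Type*} [Fintype V] (x₀ : V) (A : Learner Ω K F)
    (f : (Fin K → ℝ) → Fin K → F) (ω : Ω) (L : V → Fin K → ℝ) {w w₀ : V → ℝ}
    (r : Fin K → V → ℝ)
    (hr : ∀ i (g : F → ℝ), ∑ v, w v * g (f (L v) i) = ∑ v, w₀ v * (r i v * g (f (L v) i)))
    (T : ℕ) (G : List (Fin K × F) → ℝ) :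
    seqAvg w x₀ T (fun x => G (A.history f (fun s => L (x s)) ω T)) =
      seqAvg w₀ x₀ T (fun x => (∏ s ∈ range T, r (A.arm f (fun s => L (x s)) s ω) (x s)) *
        G (A.history f (fun s => L (x s)) ω T)) := by
  induction T generalizing G with
  | zero => simp [seqAvg_zero]
  | succ n ih =>
    have hup : ∀ (x : ℕ → V) v, ∀ t ≤ n, ∀ s < t, L (Function.update x n v s) = L (x s) :=
      fun x v t ht s hs => by rw [Function.update_of_ne (by omega)]
    have hh : ∀ (x : ℕ → V) v,
        A.history f (fun s => L (Function.update x n v s)) ω (n + 1) =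
        A.history f (fun s => L (x s)) ω n ++ [(A.arm f (fun s => L (x s)) n ω,
          f (L v) (A.arm f (fun s => L (x s)) n ω))] := by
      intro x v
      simp only [Learner.history, Learner.arm, Function.update_self]
      rw [A.history_congr f ω (hup x v n le_rfl)]
    have hp : ∀ (x : ℕ → V) v, ∏ s ∈ range (n + 1),
        r (A.arm f (fun s => L (Function.update x n v s)) s ω) (Function.update x n v s) =
        (∏ s ∈ range n, r (A.arm f (fun s => L (x s)) s ω) (x s)) *
          r (A.arm f (fun s => L (x s)) n ω) v := by
      intro x v
      rw [prod_range_succ, Function.update_self, A.arm_congr f ω (hup x v n le_rfl)]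
      congr 1
      refine prod_congr rfl fun t ht => ?_
      rw [mem_range] at ht
      rw [A.arm_congr f ω (hup x v t ht.le), Function.update_of_ne ht.ne]
    rw [seqAvg_succ, seqAvg_succ]
    simp_rw [hh, hp]
    have hstep : ∀ x : ℕ → V, ∑ v, w v * G (A.history f (fun s => L (x s)) ω n ++
          [(A.arm f (fun s => L (x s)) n ω, f (L v) (A.arm f (fun s => L (x s)) n ω))]) =
        (fun h => ∑ v, w v * G (h ++ [(A.act ω h, f (L v) (A.act ω h))]))
          (A.history f (fun s => L (x s)) ω n) := fun x => rfl
    simp_rw [hstep]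
    rw [ih fun h => ∑ v, w v * G (h ++ [(A.act ω h, f (L v) (A.act ω h))])]
    congr 1
    funext x
    have := hr (A.arm f (fun s => L (x s)) n ω) fun o =>
      G (A.history f (fun s => L (x s)) ω n ++ [(A.arm f (fun s => L (x s)) n ω, o)])
    simp only [Learner.arm] at this ⊢
    rw [this, mul_sum]
    exact sum_congr rfl fun v _ => by ring

/-- The number of rounds of a history in which the arm `j` was played. -/
def pulls (j : Fin K) (h : List (Fin K × F)) : ℝ :=
  (h.map fun p => if p.1 = j then (1 : ℝ) else 0).sum

theorem Learner.pulls_history (A : Learner Ω K F) (f : (Fin K → ℝ) → Fin K → F)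
    (l : ℕ → Fin K → ℝ) (ω : Ω) (j : Fin K) (T : ℕ) :
    pulls j (A.history f l ω T) = ∑ t ∈ range T, if A.arm f l t ω = j then (1 : ℝ) else 0 := by
  induction T with
  | zero => simp [Learner.history, pulls]
  | succ n ih =>
    rw [sum_range_succ, ← ih]
    simp [Learner.history, pulls, Learner.arm]
    rfl

/-- The weights of independent random signs, the `i`-th of mean `θ i`. -/
noncomputable def signWeight (θ : Fin K → ℝ) (v : Fin K → Bool) : ℝ :=
  ∏ i, (1 + θ i * sgn (v i)) / 2

theorem sum_signWeight_mul (θ : Fin K → ℝ) (i : Fin K) (g : Bool → ℝ) :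
    ∑ v, signWeight θ v * g (v i) = (1 + θ i) / 2 * g true + (1 - θ i) / 2 * g false := by
  have h1 : ∀ v : Fin K → Bool, signWeight θ v * g (v i) =
      ∏ k, ((1 + θ k * sgn (v k)) / 2 * if k = i then g (v k) else 1) := by
    intro v
    rw [prod_mul_distrib, signWeight, prod_ite_eq' univ i (fun k => g (v k))]
    simp
  simp_rw [h1]
  rw [← Fintype.prod_sum fun k b => (1 + θ k * sgn b) / 2 * if k = i then g b else 1]
  rw [prod_eq_single i]
  · simp [sgn, sub_eq_add_neg]
  · intro k _ hk
    simp [hk, sgn]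
    ring
  · simp

theorem sum_signWeight [NeZero K] (θ : Fin K → ℝ) : ∑ v, signWeight θ v = 1 := by
  have := sum_signWeight_mul θ 0 fun _ => 1
  simp only [mul_one] at this
  rw [this]
  ring

theorem one_add_mul_sgn_pos {a : ℝ} (ha : |a| ≤ 1 / 2) (b : Bool) : 0 < 1 + a * sgn b := by
  rw [abs_le] at ha
  cases b <;> simp [sgn] <;> linarith

theorem signWeight_nonneg {θ : Fin K → ℝ} (hθ : ∀ i, |θ i| ≤ 1 / 2) (v : Fin K → Bool) :
    0 ≤ signWeight θ v :=
  prod_nonneg fun i _ => by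
    have := one_add_mul_sgn_pos (hθ i) (v i)
    positivity

/-- The relative entropy of a fair sign with respect to a sign of mean `a` is at most `a ^ 2`. -/
theorem neg_log_add_log_le {a : ℝ} (ha : |a| ≤ 1 / 2) :
    -(Real.log (1 + a) + Real.log (1 - a)) / 2 ≤ a ^ 2 := by
  have hsq : a ^ 2 ≤ 1 / 4 := by
    have := sq_le_sq' (by linarith [abs_nonneg a]) ha
    rw [sq_abs] at this
    linarith
  rw [abs_le] at ha
  rw [← Real.log_mul (by linarith) (by linarith)]
  have hpos : 0 < (1 + a) * (1 - a) := mul_pos (by linarith) (by linarith)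
  have h1 := Real.one_sub_inv_le_log_of_pos hpos
  have h2 : ((1 + a) * (1 - a))⁻¹ ≤ 1 + 2 * a ^ 2 := by
    rw [inv_le_iff_one_le_mul₀ hpos]
    nlinarith [sq_nonneg a, mul_nonneg (sq_nonneg a) (by linarith : 0 ≤ 1 - 2 * a ^ 2)]
  linarith

/-- A linearized Pinsker inequality, before averaging: both `y - 1` and `- log y` are terms of the
relative entropy of a density `y`, and the slack `1 / 8` comes from the tangent of `log` at
`9 / 8`. -/
theorem max_sub_one_le {y : ℝ} (hy : 0 < y) :
    max (y - 1) 0 ≤ 9 * (y - 1 - Real.log y) + 1 / 8 := by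
  have h0 := Real.log_le_sub_one_of_pos hy
  have h1 := Real.log_le_sub_one_of_pos (show 0 < y / (9 / 8) by positivity)
  have h2 := Real.log_le_sub_one_of_pos (show (0 : ℝ) < 9 / 8 by norm_num)
  rw [Real.log_div hy.ne' (by norm_num)] at h1
  refine max_le ?_ ?_ <;> linarith

/-- The losses `1 / 2 ± ε i`, with the signs recorded in `v`. -/
noncomputable def signLoss (ε : Fin K → ℝ) (v : Fin K → Bool) (i : Fin K) : ℝ :=
  1 / 2 + ε i * sgn (v i)

theorem sum_signWeight_mul_signLoss (θ ε : Fin K → ℝ) (i : Fin K) :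
    ∑ v, signWeight θ v * signLoss ε v i = 1 / 2 + ε i * θ i := by
  simp only [signLoss]
  rw [sum_signWeight_mul θ i fun b => 1 / 2 + ε i * sgn b]
  simp only [sgn]
  norm_num
  ring

/-- Under bandit feedback, biasing the signs by `θ` changes the mean of a function of the history
by little, as long as the arms actually played have small bias. -/
theorem Learner.seqAvg_signWeight_le [NeZero K] (A : Learner Ω K ℝ) (ω : Ω) (ε : Fin K → ℝ)
    {θ : Fin K → ℝ} (hθ : ∀ i, |θ i| ≤ 1 / 2) (x₀ : Fin K → Bool) (T : ℕ)
    {G : List (Fin K × ℝ) → ℝ} {B : ℝ} (hG0 : ∀ h, 0 ≤ G h)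
    (hGB : ∀ x : ℕ → Fin K → Bool,
      G (A.history banditFeedback (fun s => signLoss ε (x s)) ω T) ≤ B) :
    seqAvg (signWeight θ) x₀ T
        (fun x => G (A.history banditFeedback (fun s => signLoss ε (x s)) ω T)) ≤
      seqAvg (signWeight 0) x₀ T
        (fun x => G (A.history banditFeedback (fun s => signLoss ε (x s)) ω T)) +
      B * (9 * seqAvg (signWeight 0) x₀ T (fun x => ∑ t ∈ range T,
        θ (A.arm banditFeedback (fun s => signLoss ε (x s)) t ω) ^ 2) + 1 / 8) := by
  have hB : 0 ≤ B := (hG0 _).trans (hGB fun _ => x₀)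
  have h0 : ∀ v : Fin K → Bool, 0 ≤ signWeight 0 v := signWeight_nonneg (by simp)
  let I : (ℕ → Fin K → Bool) → ℕ → Fin K := fun x t =>
    A.arm banditFeedback (fun s => signLoss ε (x s)) t ω
  let H : (ℕ → Fin K → Bool) → List (Fin K × ℝ) := fun x =>
    A.history banditFeedback (fun s => signLoss ε (x s)) ω T
  let r : Fin K → (Fin K → Bool) → ℝ := fun i v => 1 + θ i * sgn (v i)
  let Y : (ℕ → Fin K → Bool) → ℝ := fun x => ∏ s ∈ range T, r (I x s) (x s)
  have hrpos : ∀ i v, 0 < r i v := fun i v => one_add_mul_sgn_pos (hθ i) (v i)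
  have hYpos : ∀ x, 0 < Y x := fun x => prod_pos fun s _ => hrpos _ _
  have hr : ∀ i (g : ℝ → ℝ), ∑ v, signWeight θ v * g (banditFeedback (signLoss ε v) i) =
      ∑ v, signWeight 0 v * (r i v * g (banditFeedback (signLoss ε v) i)) := by
    intro i g
    simp only [banditFeedback, signLoss, r]
    rw [sum_signWeight_mul θ i fun b => g (1 / 2 + ε i * sgn b),
      sum_signWeight_mul 0 i fun b => (1 + θ i * sgn b) * g (1 / 2 + ε i * sgn b)]
    simp only [sgn, Pi.zero_apply]
    norm_num
    ring
  have hcm := fun G => A.seqAvg_history x₀ banditFeedback ω (signLoss ε) r hr T G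
  -- The likelihood ratio `Y` has mean one.
  have hY1 : seqAvg (signWeight 0) x₀ T Y = 1 := by
    have := hcm fun _ => 1
    simp only [mul_one] at this
    rw [seqAvg_const _ (sum_signWeight θ)] at this
    exact this.symm
  -- Its relative entropy adds up over the rounds.
  have hkl : seqAvg (signWeight 0) x₀ T (fun x => -1 * Real.log (Y x)) ≤
      seqAvg (signWeight 0) x₀ T (fun x => ∑ t ∈ range T, θ (I x t) ^ 2) := by
    have e1 : (fun x => -1 * Real.log (Y x)) =
        fun x => ∑ t ∈ range T, -1 * Real.log (r (I x t) (x t)) := by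
      funext x
      rw [Real.log_prod fun s _ => (hrpos _ _).ne', mul_sum]
    rw [e1, seqAvg_predictable x₀ (sum_signWeight 0)
      (fun t x v => -1 * Real.log (r (I x t) v)) (fun t x y h => ?_) T]
    · refine seqAvg_mono x₀ h0 T fun x => sum_le_sum fun t _ => ?_
      simp only [r]
      rw [sum_signWeight_mul 0 (I x t) fun b => -1 * Real.log (1 + θ (I x t) * sgn b)]
      refine le_trans (le_of_eq ?_) (neg_log_add_log_le (hθ (I x t)))
      simp [sgn, ← sub_eq_add_neg]
      ring
    · simp only [I]
      rw [A.arm_congr banditFeedback ω fun s hs => congrArg (signLoss ε) (h s hs)]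
  have hpt : ∀ x, Y x * G (H x) ≤
      G (H x) + (B * 9 * Y x + (B * 9 * (-1 * Real.log (Y x)) + (B * (1 / 8) - B * 9))) := by
    intro x
    have h1 := max_sub_one_le (hYpos x)
    have h2 : (Y x - 1) * G (H x) ≤ max (Y x - 1) 0 * B :=
      (mul_le_mul_of_nonneg_right (le_max_left _ _) (hG0 _)).trans
        (mul_le_mul_of_nonneg_left (hGB x) (le_max_right _ _))
    have h3 := mul_le_mul_of_nonneg_right h1 hB
    nlinarith
  rw [hcm G]
  refine (seqAvg_mono x₀ h0 T hpt).trans ?_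
  rw [seqAvg_add, seqAvg_add, seqAvg_add, seqAvg_const_mul, hY1, seqAvg_const_mul,
    seqAvg_const _ (sum_signWeight 0)]
  have := mul_le_mul_of_nonneg_left hkl (mul_nonneg hB (by norm_num : (0 : ℝ) ≤ 9))
  simp only [H, I] at this ⊢
  linarith

end ChangeOfMeasure

/-! ### Many arms of comparable size -/

section ManyArms

variable {Ω : Type u} [MeasurableSpace Ω] {K : ℕ}

/-- One term of the averaging argument: the mean regret, against the arm `j`, of the learner with
coin flips `ω`, when the signs of `j` are biased so that its mean loss drops by `δ`. The number of
pulls of `j` on the right is that under unbiased signs. -/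
theorem Learner.le_seqAvg_regret_biased [NeZero K] (A : Learner Ω K ℝ) (ω : Ω) {ε : Fin K → ℝ}
    {j : Fin K} (hj : 0 < ε j) {δ : ℝ} (hδ : 0 ≤ δ) (hδj : δ ≤ ε j / 2)
    (x₀ : Fin K → Bool) (T : ℕ) :
    δ * (T - (seqAvg (signWeight 0) x₀ T (fun x =>
        pulls j (A.history banditFeedback (fun s => signLoss ε (x s)) ω T)) +
      T * (9 * ((δ / ε j) ^ 2 * seqAvg (signWeight 0) x₀ T (fun x =>
        pulls j (A.history banditFeedback (fun s => signLoss ε (x s)) ω T))) + 1 / 8))) ≤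
    seqAvg (signWeight (Pi.single j (-(δ / ε j)))) x₀ T (fun x =>
      (∑ t ∈ range T, signLoss ε (x t) (A.arm banditFeedback (fun s => signLoss ε (x s)) t ω)) -
      ∑ t ∈ range T, signLoss ε (x t) j) := by
  set b : ℝ := δ / ε j with hb
  have hεb : ε j * b = δ := by rw [hb]; field_simp
  have hb0 : 0 ≤ b := div_nonneg hδ hj.le
  have hb2 : b ≤ 1 / 2 := by rw [hb, div_le_iff₀ hj]; linarith
  set θ : Fin K → ℝ := Pi.single j (-b) with hθdef
  have hθ : ∀ i, |θ i| ≤ 1 / 2 := by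
    intro i
    by_cases h : i = j
    · subst h
      rw [hθdef, Pi.single_eq_same, abs_neg, abs_of_nonneg hb0]
      exact hb2
    · rw [hθdef, Pi.single_eq_of_ne h]
      norm_num
  have hpulls := A.pulls_history banditFeedback
  have hcm := A.seqAvg_signWeight_le ω ε hθ x₀ T (G := pulls j) (B := T)
    (fun h => List.sum_nonneg fun y hy => by
      obtain ⟨p, -, rfl⟩ := List.mem_map.1 hy
      split_ifs <;> norm_num)
    (fun x => by
      rw [hpulls]
      refine (sum_le_sum (g := fun _ => (1 : ℝ)) fun t _ => ?_).trans (by simp)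
      split_ifs <;> norm_num)
  have hθsq : ∀ i, θ i ^ 2 = b ^ 2 * if i = j then (1 : ℝ) else 0 := by
    intro i
    by_cases h : i = j
    · subst h
      simp [hθdef]
    · simp [hθdef, h]
  simp only [hθsq, ← mul_sum, ← hpulls] at hcm
  rw [seqAvg_const_mul] at hcm
  have hmean : ∀ i, ∑ v, signWeight θ v * signLoss ε v i =
      1 / 2 - δ * if i = j then (1 : ℝ) else 0 := by
    intro i
    rw [sum_signWeight_mul_signLoss]
    by_cases h : i = j
    · subst h
      simp [hθdef, hεb]
      ring
    · simp [hθdef, h]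
  have hplay := A.seqAvg_loss x₀ (sum_signWeight θ) banditFeedback ω (signLoss ε) T
  have hfix := seqAvg_predictable x₀ (sum_signWeight θ) (fun _ _ v => signLoss ε v j)
    (fun _ _ _ _ => rfl) T
  rw [seqAvg_sub, hplay, hfix]
  simp only [hmean, sum_sub_distrib, ← mul_sum, ← hpulls]
  rw [seqAvg_sub, seqAvg_const _ (sum_signWeight θ), seqAvg_const_mul,
    seqAvg_const _ (sum_signWeight θ)]
  have := mul_le_mul_of_nonneg_left hcm hδ
  simp
  linarith

/-- The bandit lower bound when no single arm carries most of `∑ j, ε j ^ 2`. -/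
theorem Learner.exists_loss_spread [NeZero K] (A : Learner Ω K ℝ) (P : Measure Ω)
    [IsProbabilityMeasure P] {ε : Fin K → ℝ} (hε : ∀ j, 0 ≤ ε j) {T : ℕ} (hT : 0 < T)
    (hlarge : ∀ j, 0 < ε j → 2 / (T : ℝ) * ∑ i, ε i ^ 2 ≤ ε j ^ 2)
    (hspread : ∀ j, 2 * ε j ^ 2 ≤ ∑ i, ε i ^ 2) (hpos : 0 < ∑ i, ε i ^ 2) :
    ∃ l : ℕ → Fin K → ℝ, (∀ t i, |l t i - 1 / 2| ≤ ε i) ∧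
      √(T * ∑ j, ε j ^ 2) / 36 ≤ A.expectedRegret P banditFeedback l T := by
  set S : ℝ := ∑ i, ε i ^ 2 with hS
  have hT' : (0 : ℝ) < T := by exact_mod_cast hT
  -- The gap `δ` balances `δ * T` against the information `δ ^ 2 * T / S` gained about it.
  set δ : ℝ := √(S / T) / 9 with hδdef
  have hδ : 0 < δ := by positivity
  have hδsq : 81 * δ ^ 2 * T = S := by
    rw [hδdef, div_pow, Real.sq_sqrt (by positivity)]
    field_simp
    norm_num
  have hgoal : √(T * S) / 36 = δ * T / 4 := by
    have : √(T * S) = 9 * δ * T := by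
      rw [Real.sqrt_eq_iff_mul_self_eq (by positivity) (by positivity), ← hδsq]
      ring
    rw [this]
    ring
  have hδj : ∀ j, 0 < ε j → δ ≤ ε j / 2 := by
    intro j hj
    refine le_of_sq_le_sq ?_ (by positivity)
    have h := hlarge j hj
    have e : 2 / (T : ℝ) * S = 162 * δ ^ 2 := by
      rw [← hδsq]
      field_simp
      norm_num
    rw [e] at h
    nlinarith [sq_nonneg δ]
  let x₀ : Fin K → Bool := fun _ => true
  let θ : Fin K → Fin K → ℝ := fun j => Pi.single j (-(δ / ε j))
  let l : (ℕ → Fin K → Bool) → ℕ → Fin K → ℝ := fun x t => signLoss ε (x t)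
  let R : Fin K → Ω → (ℕ → Fin K → Bool) → ℝ := fun j ω x =>
    (∑ t ∈ range T, l x t (A.arm banditFeedback (l x) t ω)) - ∑ t ∈ range T, l x t j
  have hRint : ∀ j x, Integrable (fun ω => R j ω x) P := fun j x =>
    (A.integrable_loss P banditFeedback (l x) T).sub (integrable_const _)
  have hswap := fun j => integral_seqAvg (w := signWeight (θ j)) x₀ P T (R j) (hRint j)
  have hω : ∀ ω, S * (δ * T / 4) ≤
      ∑ j, ε j ^ 2 * seqAvg (signWeight (θ j)) x₀ T (R j ω) := by
    intro ω
    set N : Fin K → ℝ := fun j => seqAvg (signWeight 0) x₀ T (fun x =>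
      pulls j (A.history banditFeedback (l x) ω T)) with hN
    have hN0 : ∀ j, 0 ≤ N j := by
      intro j
      rw [hN, ← seqAvg_const x₀ (sum_signWeight (0 : Fin K → ℝ)) T 0]
      refine seqAvg_mono x₀ (signWeight_nonneg (by simp)) T fun x => ?_
      rw [A.pulls_history]
      exact sum_nonneg fun t _ => by split_ifs <;> norm_num
    have hNsum : ∑ j, N j = T := by
      simp only [hN]
      rw [← seqAvg_sum]
      have : ∀ x, ∑ j, pulls j (A.history banditFeedback (l x) ω T) = T := by
        intro x
        simp only [A.pulls_history]
        rw [sum_comm]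
        simp
      simp only [this]
      exact seqAvg_const _ (sum_signWeight 0) _ _
    have hterm : ∀ j, ε j ^ 2 * (7 / 8 * δ * T) - δ * (S / 2) * N j - 9 * T * δ ^ 3 * N j ≤
        ε j ^ 2 * seqAvg (signWeight (θ j)) x₀ T (R j ω) := by
      intro j
      have hδN : 0 ≤ δ * N j := mul_nonneg hδ.le (hN0 j)
      have h2 := mul_le_mul_of_nonneg_right (hspread j) hδN
      rcases (hε j).eq_or_lt with h0 | hj
      · rw [← h0]
        have : 0 ≤ 9 * T * δ ^ 3 * N j := mul_nonneg (by positivity) (hN0 j)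
        have : 0 ≤ S * (δ * N j) := mul_nonneg hpos.le hδN
        nlinarith
      · have h := mul_le_mul_of_nonneg_left
          (A.le_seqAvg_regret_biased ω hj hδ.le (hδj j hj) x₀ T) (sq_nonneg (ε j))
        refine le_trans ?_ h
        have e : ε j ^ 2 * (δ * (T - (N j + T * (9 * ((δ / ε j) ^ 2 * N j) + 1 / 8)))) =
            ε j ^ 2 * (7 / 8 * δ * T) - ε j ^ 2 * (δ * N j) - 9 * T * δ ^ 3 * N j := by
          field_simp
          ring
        refine le_trans ?_ e.ge
        linarith
    refine le_trans ?_ (sum_le_sum fun j _ => hterm j)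
    simp only [sum_sub_distrib, ← sum_mul, ← mul_sum, hNsum, ← hS]
    have e : 9 * (T : ℝ) * δ ^ 3 * T = S * (δ * T) / 9 := by
      rw [← hδsq]
      ring
    rw [e]
    have : 0 ≤ S * (δ * T) := by positivity
    linarith
  have hsum : S * (δ * T / 4) ≤
      ∑ j, ε j ^ 2 * seqAvg (signWeight (θ j)) x₀ T (fun x => ∫ ω, R j ω x ∂P) := by
    have h := integral_mono (μ := P) (integrable_const _)
      (integrable_finsetSum univ fun j _ => (hswap j).1.const_mul (ε j ^ 2)) hω
    rw [integral_finsetSum univ fun j _ => (hswap j).1.const_mul (ε j ^ 2)] at h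
    simpa [integral_const_mul, (hswap _).2] using h
  obtain ⟨j, hj, hjle⟩ : ∃ j, 0 < ε j ∧
      δ * T / 4 ≤ seqAvg (signWeight (θ j)) x₀ T (fun x => ∫ ω, R j ω x ∂P) := by
    by_contra! hlt
    refine absurd hsum (not_le.2 ?_)
    rw [hS, sum_mul]
    obtain ⟨k, -, hk⟩ := exists_ne_zero_of_sum_ne_zero (hS ▸ hpos.ne')
    have hk' : 0 < ε k := lt_of_le_of_ne (hε k) fun h => hk (by rw [← h]; norm_num)
    refine sum_lt_sum (fun i _ => ?_)
      ⟨k, mem_univ k, mul_lt_mul_of_pos_left (hlt k hk') (by positivity)⟩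
    rcases (hε i).eq_or_lt with h0 | hi
    · simp [← h0]
    · exact mul_le_mul_of_nonneg_left (hlt i hi).le (sq_nonneg _)
  have hθ : ∀ i, |θ j i| ≤ 1 / 2 := by
    intro i
    by_cases h : i = j
    · subst h
      simp only [θ, Pi.single_eq_same, abs_neg]
      rw [abs_of_pos (div_pos hδ hj), div_le_iff₀ hj]
      linarith [hδj i hj]
    · simp [θ, Pi.single_eq_of_ne h]
  obtain ⟨x, hx⟩ := exists_seqAvg_le x₀ (signWeight_nonneg hθ) (sum_signWeight (θ j)) T
    fun x => ∫ ω, R j ω x ∂P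
  refine ⟨l x, fun t i => ?_, ?_⟩
  · simp only [l, signLoss, add_sub_cancel_left]
    rw [abs_mul, abs_sgn, mul_one, abs_of_nonneg (hε i)]
  · rw [hgoal]
    refine (hjle.trans hx).trans (le_trans (le_of_eq ?_)
      (A.le_expectedRegret P banditFeedback (l x) T j))
    simp only [R]
    rw [integral_sub (A.integrable_loss P banditFeedback (l x) T) (integrable_const _)]
    simp

end ManyArms

end NonstochasticBandit

theorem theorem2 :
    ∃ c : ℝ, 0 < c ∧
      ∀ (T K : ℕ), 1 < T → 1 < K →
      ∀ ε : Fin K → ℝ, (∀ j, 0 ≤ ε j) →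
        (∀ j, 0 < ε j → 2 / (T : ℝ) * ∑ i, ε i ^ 2 ≤ ε j ^ 2) →
      ∃ m : Fin K → ℝ,
        ((∀ j, ε j ≤ 1 / 2) → ∀ j, 0 ≤ m j - ε j ∧ m j + ε j ≤ 1) ∧
        (∀ (Ω : Type u) [MeasurableSpace Ω] (P : MeasureTheory.Measure Ω)
            [MeasureTheory.IsProbabilityMeasure P]
            (A : NonstochasticBandit.Learner Ω K ℝ),
          ∃ l : ℕ → Fin K → ℝ, (∀ t < T, ∀ j, |l t j - m j| ≤ ε j) ∧
            c * Real.sqrt (T * ∑ j, ε j ^ 2) ≤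
              A.expectedRegret P NonstochasticBandit.banditFeedback l T) ∧
        (∀ (Ω : Type u) [MeasurableSpace Ω] (P : MeasureTheory.Measure Ω)
            [MeasureTheory.IsProbabilityMeasure P]
            (A : NonstochasticBandit.Learner Ω K (Fin K → ℝ)),
          ∃ l : ℕ → Fin K → ℝ, (∀ t < T, ∀ j, |l t j - m j| ≤ ε j) ∧
            c * Real.sqrt (T * ⨆ j, ε j ^ 2) ≤
              A.expectedRegret P NonstochasticBandit.fullFeedback l T) := by
  refine ⟨1 / 36, by norm_num, fun T K hT hK ε hε hlarge => ⟨fun _ => 1 / 2,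
    fun h j => ⟨by linarith [h j], by linarith [h j]⟩, ?_, ?_⟩⟩
  all_goals
    intro Ω _ P _ A
    have : NeZero K := ⟨by omega⟩
    have : Nontrivial (Fin K) := Fin.nontrivial_iff_two_le.2 hK
  · by_cases hdom : ∃ j, ∑ i, ε i ^ 2 ≤ 2 * ε j ^ 2
    · obtain ⟨j, hj⟩ := hdom
      obtain ⟨j', hj'⟩ := exists_ne j
      obtain ⟨l, hl, hreg⟩ := NonstochasticBandit.exists_loss_single_arm A P
        NonstochasticBandit.banditFeedback hε hj' (by omega : 0 < T)
      refine ⟨l, fun t _ => hl t, le_trans ?_ hreg⟩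
      have : Real.sqrt (T * ∑ i, ε i ^ 2) ≤ 2 * (ε j * Real.sqrt T) := by
        refine Real.sqrt_le_iff.2 ⟨mul_nonneg two_pos.le
          (mul_nonneg (hε j) (Real.sqrt_nonneg _)), ?_⟩
        rw [mul_pow, mul_pow, Real.sq_sqrt (Nat.cast_nonneg T)]
        nlinarith [mul_le_mul_of_nonneg_left hj (Nat.cast_nonneg (α := ℝ) T),
          mul_nonneg (sq_nonneg (ε j)) (Nat.cast_nonneg (α := ℝ) T)]
      linarith [mul_nonneg (hε j) (Real.sqrt_nonneg T)]
    · push Not at hdom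
      obtain ⟨l, hl, hreg⟩ := A.exists_loss_spread P hε (by omega : 0 < T) hlarge
        (fun j => (hdom j).le) ((mul_nonneg two_pos.le (sq_nonneg (ε 0))).trans_lt (hdom 0))
      exact ⟨l, fun t _ => hl t, le_trans (by linarith) hreg⟩
  · obtain ⟨j, hj⟩ := exists_eq_ciSup_of_finite (f := fun j => ε j ^ 2)
    obtain ⟨j', hj'⟩ := exists_ne j
    obtain ⟨l, hl, hreg⟩ := NonstochasticBandit.exists_loss_single_arm A P
      NonstochasticBandit.fullFeedback hε hj' (by omega : 0 < T)
    refine ⟨l, fun t _ => hl t, le_trans ?_ hreg⟩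
    rw [← hj, Real.sqrt_mul (Nat.cast_nonneg T), Real.sqrt_sq (hε j)]
    linarith [mul_nonneg (hε j) (Real.sqrt_nonneg T)]
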